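/- Let $d\ge 1$ be an integer and $\beta>0$. A set $\mathcal P$ of $n$ stochastic points in $\mathbb R^d$ (existential model) consists of points $v_1,\dots,v_n\in\mathbb R^d$ (possibly sharing locations) with probabilities $p_1,\dots,p_n\in[0,1]$; point $v_i$ is present with probability $p_i$, independently of the other points. For a finite nonempty collection $P$ of points and $u\in\mathbb R^d$ let $\omega(P,u)=\max_{p\in P}\langle u,p\rangle+\max_{p\in P}\langle -u,p\rangle$ be the directional width, with $\omega(\emptyset,u)=0$, and let $\omega(\mathcal P,u)=\mathbb E_{P\sim\mathcal P}[\omega(P,u)]$, where $P$ is the random collection of the points of $\mathcal P$ that are present. A set $\mathcal S$ of stochastic points is an $\varepsilon$-exp-kernel of $\mathcal P$ if $(1-\varepsilon)\,\omega(\mathcal P,u)\le\omega(\mathcal S,u)\le\omega(\mathcal P,u)$ for all $u\in\mathbb R^d$. A subcollection $Q\subseteq P$ of a finite collection of (deterministic) points is a $\delta$-kernel of $P$ if $(1-\delta)\,\omega(P,u)\le\omega(Q,u)\le\omega(P,u)$ for all $u\in\mathbb R^d$, and $Q\neq\emptyset$ if $P\ne\emptyset$. A peeling of $\mathcal P$ with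 $L$ rounds of $\delta$-kernels is a sequence $Q_1,\dots,Q_L$ in which each $Q_k$ is a $\delta$-kernel of the collection of the locations of the points of $\mathcal P$ that are not in $Q_1\cup\dots\cup Q_{k-1}$. **Theorem.** There are constants $c\in(0,1]$ and $C>0$, depending only on $d$ and $\beta$, such that for every $\varepsilon\in(0,1)$ there is an integer $L\ge 0$ with $L\le C\log(2/\varepsilon)$ for which the following holds for every $n\ge 0$ and every set $\mathcal P$ of $n$ stochastic points in $\mathbb R^d$ all of whose existential probabilities are at least $\beta$. 1. There is a subset $\mathcal S$ of the points of $\mathcal P$ which, taken with the original probabilities, is an $\varepsilon$-exp-kernel of $\mathcal P$ and has size $$|\mathcal S|\le C\,\varepsilon^{-(d-1)/2}\log(2/\varepsilon).$$ Moreover $\mathcal S=Q_1\cup\dots\cup Q_L$ for a peeling $Q_1,\dots,Q_L$ of $\mathcal P$ with $L$ rounds of $c\varepsilon$-kernels with $|Q_k|\le C\varepsilon^{-(d-1)/2}$ for all $k$. 2. For every peeling $Q_1,\dots,Q_L$ of $\mathcal P$ with $L$ rounds of $c\varepsilon$-kernels, the points of $Q_1\cup\dots\cup Q_L$, taken with their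 original probabilities, form an $\varepsilon$-exp-kernel of $\mathcal P$. (For $\varepsilon\le 1/2$ one has $\log(2/\varepsilon)\le 2\log(1/\varepsilon)$, so the bounds on the size and on the number of rounds are $O(\varepsilon^{-(d-1)/2}\log(1/\varepsilon))$ and $O(\log(1/\varepsilon))$.) -/

import Mathlib

/-- The support function `f(R, u) = max_{i ∈ R} ⟨u, x i⟩` of the finite family of points `x i`,
`i ∈ R`, in direction `u`. The value `0` for the empty family makes the empty family have
directional width `0` in every direction. -/
noncomputable def supportFn {ι : Type*} {d : ℕ} (x : ι → EuclideanSpace ℝ (Fin d))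
    (R : Finset ι) (u : EuclideanSpace ℝ (Fin d)) : ℝ :=
  open Classical in
  if h : R.Nonempty then R.sup' h (fun i => inner ℝ u (x i)) else 0

/-- The directional width `ω(R, u) = f(R, u) + f(R, -u)`. -/
noncomputable def dirWidth {ι : Type*} {d : ℕ} (x : ι → EuclideanSpace ℝ (Fin d))
    (R : Finset ι) (u : EuclideanSpace ℝ (Fin d)) : ℝ :=
  supportFn x R u + supportFn x R (-u)

/-- `Q` is a (deterministic) `ε`-kernel of the finite family of points `x i`, `i ∈ R`: a subfamily,
nonempty if `R` is, whose width in every direction is at least `1 - ε` times that of `R`. -/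
def IsKernel {ι : Type*} {d : ℕ} (ε : ℝ) (x : ι → EuclideanSpace ℝ (Fin d))
    (Q R : Finset ι) : Prop :=
  Q ⊆ R ∧ (R.Nonempty → Q.Nonempty) ∧
    ∀ u : EuclideanSpace ℝ (Fin d),
      (1 - ε) * dirWidth x R u ≤ dirWidth x Q u ∧ dirWidth x Q u ≤ dirWidth x R u

/-- A set of stochastic points in `ℝ^d` in the existential uncertainty model, indexed by `ι`: point
`i` has location `pt i` and is present, independently of the others, with probability `prob i`.
Several points may share a location. -/
structure StochasticPoints (ι : Type*) (d : ℕ) where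
  pt : ι → EuclideanSpace ℝ (Fin d)
  prob : ι → ℝ
  prob_mem : ∀ i, prob i ∈ Set.Icc (0 : ℝ) 1

namespace StochasticPoints

/-- The probability that `R` is exactly the set of points that are present. -/
def realizationProb {ι : Type*} [Fintype ι] [DecidableEq ι] {d : ℕ}
    (P : StochasticPoints ι d) (R : Finset ι) : ℝ :=
  (∏ i ∈ R, P.prob i) * ∏ i ∈ Finset.univ \ R, (1 - P.prob i)

theorem sum_realizationProb {ι : Type*} [Fintype ι] [DecidableEq ι] {d : ℕ}
    (P : StochasticPoints ι d) : ∑ R : Finset ι, P.realizationProb R = 1 := by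
  have h := Finset.prod_add P.prob (fun i => 1 - P.prob i) Finset.univ
  simp only [add_sub_cancel, Finset.prod_const_one, Finset.powerset_univ] at h
  exact h.symm

/-- The expected directional width `ω(P, u)` over the random realization of `P`. -/
noncomputable def expWidth {ι : Type*} [Fintype ι] [DecidableEq ι] {d : ℕ}
    (P : StochasticPoints ι d) (u : EuclideanSpace ℝ (Fin d)) : ℝ :=
  ∑ R : Finset ι, P.realizationProb R * dirWidth P.pt R u

/-- The stochastic points of `P` with index in `S`, with their original probabilities. -/
def restrict {ι : Type*} {d : ℕ} (P : StochasticPoints ι d) (S : Finset ι) :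
    StochasticPoints {i // i ∈ S} d where
  pt i := P.pt i
  prob i := P.prob i
  prob_mem i := P.prob_mem i

/-- The set `T` of stochastic points is an `ε`-exp-kernel of `P`. -/
def IsExpKernel {κ ι : Type*} [Fintype κ] [DecidableEq κ] [Fintype ι] [DecidableEq ι] {d : ℕ}
    (ε : ℝ) (T : StochasticPoints κ d) (P : StochasticPoints ι d) : Prop :=
  ∀ u : EuclideanSpace ℝ (Fin d),
    (1 - ε) * P.expWidth u ≤ T.expWidth u ∧ T.expWidth u ≤ P.expWidth u

end StochasticPoints

/-- The union of the sets `Q 0, …, Q (k - 1)` chosen in the first `k` rounds. -/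
def peeled {ι : Type*} [DecidableEq ι] (Q : ℕ → Finset ι) (k : ℕ) : Finset ι :=
  (Finset.range k).biUnion Q

/-- `Q 0, …, Q (L - 1)` arises by `L` rounds of peeling `δ`-kernels off the points `x`: in each
round, `Q k` is a deterministic `δ`-kernel of the points that were not removed before, and is then
removed as well. -/
def IsPeeling {ι : Type*} [Fintype ι] [DecidableEq ι] {d : ℕ} (δ : ℝ)
    (x : ι → EuclideanSpace ℝ (Fin d)) (L : ℕ) (Q : ℕ → Finset ι) : Prop :=
  ∀ k < L, IsKernel δ x (Q k) (Finset.univ \ peeled Q k)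

/-! Fix a direction `u` and let `w` be the width of all the points. Two points realizing `w` are
both present with probability at least `β ^ 2`, so the expected width is at least `β ^ 2 * w`, and
it suffices to lose `ε * β ^ 2 * w` (`sq_mul_dirWidth_univ_le_expWidth`). If peeling does not
exhaust the points, each round supplies a point extreme in its kernel. Once one of these `L`
distinct points is present, the unpeeled points, which all survived to its round, exceed it by at
most `δ * w` in direction `u` (`IsPeeling.exists_witnesses`). All are absent with probability at
most `(1 - β) ^ L`, and then the loss is at most `w`. Adding the directions `u` and `-u` gives loss
`(2 * δ + 2 * (1 - β) ^ L) * w`, so `δ` of order `ε` and `L` of order `log (2 / ε)` suffice. Small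
kernels (`exists_isKernel`) come from coordinates placing the points in a cube, followed by nearest
neighbours of a net on a larger cube's boundary; the error is quadratic in the mesh, whence the
exponent `(d - 1) / 2`. -/

/-! ### Support functions and directional width. -/

section Width

variable {ι : Type*} {d : ℕ} (x : ι → EuclideanSpace ℝ (Fin d)) {Q R : Finset ι}
  (u : EuclideanSpace ℝ (Fin d))

theorem inner_le_supportFn {i : ι} (hi : i ∈ R) : inner ℝ u (x i) ≤ supportFn x R u := by
  rw [supportFn, dif_pos ⟨i, hi⟩]
  exact Finset.le_sup' (fun i => inner ℝ u (x i)) hi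

theorem exists_supportFn_eq (hR : R.Nonempty) : ∃ i ∈ R, supportFn x R u = inner ℝ u (x i) := by
  rw [supportFn, dif_pos hR]
  exact Finset.exists_mem_eq_sup' hR _

theorem supportFn_mono (hQ : Q.Nonempty) (h : Q ⊆ R) : supportFn x Q u ≤ supportFn x R u := by
  obtain ⟨i, hi, e⟩ := exists_supportFn_eq x u hQ
  exact e ▸ inner_le_supportFn x u (h hi)

theorem dirWidth_empty : dirWidth x ∅ u = 0 := by
  simp [dirWidth, supportFn]

theorem dirWidth_neg : dirWidth x R (-u) = dirWidth x R u := by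
  simp [dirWidth, add_comm]

theorem inner_sub_le_dirWidth {i j : ι} (hi : i ∈ R) (hj : j ∈ R) :
    inner ℝ u (x i - x j) ≤ dirWidth x R u := by
  have h1 := inner_le_supportFn x u hi
  have h2 := inner_le_supportFn x (-u) hj
  rw [inner_neg_left] at h2
  rw [inner_sub_right, dirWidth]
  linarith

theorem exists_dirWidth_eq (hR : R.Nonempty) :
    ∃ i ∈ R, ∃ j ∈ R, dirWidth x R u = inner ℝ u (x i - x j) := by
  obtain ⟨i, hi, e⟩ := exists_supportFn_eq x u hR
  obtain ⟨j, hj, e'⟩ := exists_supportFn_eq x (-u) hR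
  refine ⟨i, hi, j, hj, ?_⟩
  rw [dirWidth, e, e', inner_neg_left, inner_sub_right, sub_eq_add_neg]

theorem dirWidth_nonneg : 0 ≤ dirWidth x R u := by
  rcases R.eq_empty_or_nonempty with rfl | ⟨i, hi⟩
  · rw [dirWidth_empty]
  · simpa using inner_sub_le_dirWidth x u hi hi

theorem dirWidth_mono (h : Q ⊆ R) : dirWidth x Q u ≤ dirWidth x R u := by
  rcases Q.eq_empty_or_nonempty with rfl | hQ
  · rw [dirWidth_empty]
    exact dirWidth_nonneg x u
  · exact add_le_add (supportFn_mono x u hQ h) (supportFn_mono x (-u) hQ h)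

/-- Passing to `Q` cannot raise the support function in direction `-u`, so the loss in direction `u`
alone is at most the loss of width. -/
theorem IsKernel.supportFn_le {x : ι → EuclideanSpace ℝ (Fin d)} {δ : ℝ} (h : IsKernel δ x Q R)
    (hR : R.Nonempty) : supportFn x R u ≤ supportFn x Q u + δ * dirWidth x R u := by
  have h1 := (h.2.2 u).1
  have h2 := supportFn_mono x (-u) (h.2.1 hR) h.1
  have h3 : dirWidth x Q u = supportFn x Q u + supportFn x Q (-u) := rfl
  have h4 : dirWidth x R u = supportFn x R u + supportFn x R (-u) := rfl
  linarith

/-- A subfamily that loses at most `δ / 2` times the width in every direction is a `δ`-kernel. -/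
theorem isKernel_of_forall_exists {x : ι → EuclideanSpace ℝ (Fin d)} {δ : ℝ} (hQ : Q ⊆ R)
    (h : ∀ u : EuclideanSpace ℝ (Fin d), ∀ p ∈ R, ∃ q ∈ Q,
      inner ℝ u (x p) ≤ inner ℝ u (x q) + δ / 2 * dirWidth x R u) : IsKernel δ x Q R := by
  have key : ∀ u : EuclideanSpace ℝ (Fin d), R.Nonempty →
      supportFn x R u ≤ supportFn x Q u + δ / 2 * dirWidth x R u := fun u hR => by
    obtain ⟨p, hp, e⟩ := exists_supportFn_eq x u hR
    obtain ⟨q, hq, hpq⟩ := h u p hp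
    rw [e]
    exact hpq.trans (by gcongr; exact inner_le_supportFn x u hq)
  refine ⟨hQ, fun ⟨p, hp⟩ => ?_, fun u => ⟨?_, dirWidth_mono x u hQ⟩⟩
  · obtain ⟨q, hq, -⟩ := h 0 p hp
    exact ⟨q, hq⟩
  · rcases R.eq_empty_or_nonempty with rfl | hR
    · rw [dirWidth_empty, mul_zero]
      exact dirWidth_nonneg x u
    · have h1 := key u hR
      have h2 := key (-u) hR
      rw [dirWidth_neg] at h2
      have h3 : dirWidth x Q u = supportFn x Q u + supportFn x Q (-u) := rfl
      have h4 : dirWidth x R u = supportFn x R u + supportFn x R (-u) := rfl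
      linarith

end Width

/-! ### Expected width and probabilities of presence. -/

namespace StochasticPoints

section Expectation

variable {ι : Type*} {d : ℕ} (P : StochasticPoints ι d)

theorem dirWidth_restrict (S : Finset ι) (T : Finset {i // i ∈ S})
    (u : EuclideanSpace ℝ (Fin d)) : dirWidth (P.restrict S).pt T u =
      dirWidth P.pt (T.map (Function.Embedding.subtype (· ∈ S))) u := by
  have key : ∀ v, supportFn (P.restrict S).pt T v =
      supportFn P.pt (T.map (Function.Embedding.subtype (· ∈ S))) v := fun v => by
    rcases T.eq_empty_or_nonempty with rfl | hT
    · simp [supportFn]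
    · rw [supportFn, supportFn, dif_pos hT, dif_pos (hT.map), Finset.sup'_map]
      rfl
  rw [dirWidth, dirWidth, key, key]

variable [DecidableEq ι]

theorem realizationProb_restrict (S : Finset ι) (T : Finset {i // i ∈ S}) :
    (P.restrict S).realizationProb T =
      (∏ i ∈ T.map (Function.Embedding.subtype (· ∈ S)), P.prob i) *
        ∏ i ∈ S \ T.map (Function.Embedding.subtype (· ∈ S)), (1 - P.prob i) := by
  have h : S \ T.map (Function.Embedding.subtype (· ∈ S)) =
      (Finset.univ \ T).map (Function.Embedding.subtype (· ∈ S)) := by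
    ext i
    by_cases hi : i ∈ S <;> simp [hi]
  rw [h, Finset.prod_map, Finset.prod_map]
  rfl

variable [Fintype ι]

theorem realizationProb_nonneg (R : Finset ι) : 0 ≤ P.realizationProb R :=
  mul_nonneg (Finset.prod_nonneg fun i _ => (P.prob_mem i).1)
    (Finset.prod_nonneg fun i _ => sub_nonneg.2 (P.prob_mem i).2)

/-- The probability that all points of `A` and no points of `B` are present. -/
theorem sum_realizationProb_filter {A B : Finset ι} (hAB : Disjoint A B) :
    ∑ R with A ⊆ R ∧ Disjoint B R, P.realizationProb R =
      (∏ i ∈ A, P.prob i) * ∏ i ∈ B, (1 - P.prob i) := by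
  -- With `prob` zeroed on `B` and `1 - prob` zeroed on `A`, the terms of the expanded product that
  -- lie outside the event vanish.
  have h := Finset.prod_add (fun i => if i ∈ B then 0 else P.prob i)
    (fun i => if i ∈ A then 0 else 1 - P.prob i) Finset.univ
  rw [Finset.powerset_univ] at h
  rw [Finset.sum_filter]
  trans ∏ i, ((if i ∈ B then 0 else P.prob i) + if i ∈ A then 0 else 1 - P.prob i)
  · rw [h]
    refine Finset.sum_congr rfl fun R _ => ?_
    split_ifs with hR
    · refine congrArg₂ _ (Finset.prod_congr rfl fun i hi => ?_)
        (Finset.prod_congr rfl fun i hi => ?_)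
      · rw [if_neg (Finset.disjoint_right.1 hR.2 hi)]
      · rw [if_neg fun hA => (Finset.mem_sdiff.1 hi).2 (hR.1 hA)]
    · rw [not_and_or, Finset.not_subset, Finset.not_disjoint_iff] at hR
      rcases hR with ⟨i, hi, hiR⟩ | ⟨i, hi, hiR⟩
      · rw [Finset.prod_eq_zero (i := i) (s := Finset.univ \ R) (by simpa using hiR)
          (by rw [if_pos hi]), mul_zero]
      · rw [Finset.prod_eq_zero hiR (by rw [if_pos hi]), zero_mul]
  · trans ∏ i, ((if i ∈ A then P.prob i else 1) * if i ∈ B then 1 - P.prob i else 1)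
    · refine Finset.prod_congr rfl fun i _ => ?_
      by_cases hA : i ∈ A
      · simp [hA, Finset.disjoint_left.1 hAB hA]
      · by_cases hB : i ∈ B <;> simp [hA, hB]
    · rw [Finset.prod_mul_distrib, Finset.prod_ite_mem, Finset.prod_ite_mem, Finset.univ_inter,
        Finset.univ_inter]

/-- Couples `P` with its restriction on one probability space, so that widths can be compared
realization by realization. The sum is grouped by the trace `R ∩ S`. -/
theorem expWidth_restrict (S : Finset ι) (u : EuclideanSpace ℝ (Fin d)) :
    (P.restrict S).expWidth u = ∑ R, P.realizationProb R * dirWidth P.pt (R ∩ S) u := by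
  rw [← Finset.sum_fiberwise_of_maps_to (s := Finset.univ) (t := S.powerset) (g := fun R => R ∩ S)
    (fun R _ => Finset.mem_powerset.2 Finset.inter_subset_right)]
  have h : ∀ T ∈ S.powerset, ∑ R with R ∩ S = T, P.realizationProb R * dirWidth P.pt (R ∩ S) u =
      ((∏ i ∈ T, P.prob i) * ∏ i ∈ S \ T, (1 - P.prob i)) * dirWidth P.pt T u := by
    intro T hT
    rw [← P.sum_realizationProb_filter Finset.disjoint_sdiff, Finset.sum_mul]
    have e : ∀ R : Finset ι, R ∩ S = T ↔ T ⊆ R ∧ Disjoint (S \ T) R := fun R => by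
      rw [Finset.mem_powerset] at hT
      constructor
      · rintro rfl
        refine ⟨Finset.inter_subset_left, Finset.disjoint_left.2 fun i hi hR => ?_⟩
        simp only [Finset.mem_sdiff, Finset.mem_inter, not_and] at hi
        exact hi.2 hR hi.1
      · rintro ⟨h1, h2⟩
        ext i
        refine ⟨fun hi => ?_, fun hi => Finset.mem_inter.2 ⟨h1 hi, hT hi⟩⟩
        rw [Finset.mem_inter] at hi
        by_contra hiT
        exact Finset.disjoint_left.1 h2 (Finset.mem_sdiff.2 ⟨hi.2, hiT⟩) hi.1
    refine Finset.sum_congr (Finset.filter_congr fun R _ => e R) fun R hR => ?_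
    rw [(e R).2 (Finset.mem_filter.1 hR).2]
  rw [Finset.sum_congr rfl h, expWidth]
  refine Finset.sum_bij' (fun T _ => T.map (Function.Embedding.subtype (· ∈ S)))
    (fun T _ => T.subtype (· ∈ S)) (fun T _ => ?_) (fun _ _ => Finset.mem_univ _)
    (fun T _ => ?_) (fun T hT => ?_) (fun T _ => ?_)
  · exact Finset.mem_powerset.2 (Finset.map_subtype_subset T)
  · ext i
    simp
  · exact Finset.subtype_map_of_mem fun i hi => Finset.mem_powerset.1 hT hi
  · rw [P.realizationProb_restrict, P.dirWidth_restrict]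

theorem expWidth_restrict_le (S : Finset ι) (u : EuclideanSpace ℝ (Fin d)) :
    (P.restrict S).expWidth u ≤ P.expWidth u := by
  rw [expWidth_restrict]
  exact Finset.sum_le_sum fun R _ => mul_le_mul_of_nonneg_left
    (dirWidth_mono _ _ Finset.inter_subset_left) (P.realizationProb_nonneg R)

theorem sq_mul_dirWidth_univ_le_expWidth {β : ℝ} (hβ : 0 ≤ β) (hβ1 : β ≤ 1)
    (hP : ∀ i, β ≤ P.prob i) (u : EuclideanSpace ℝ (Fin d)) :
    β ^ 2 * dirWidth P.pt Finset.univ u ≤ P.expWidth u := by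
  rcases (Finset.univ : Finset ι).eq_empty_or_nonempty with h | h
  · rw [h, dirWidth_empty, mul_zero]
    exact Finset.sum_nonneg fun R _ => mul_nonneg (P.realizationProb_nonneg R)
      (dirWidth_nonneg _ _)
  obtain ⟨i, -, j, -, hij⟩ := exists_dirWidth_eq P.pt u h
  have h1 : β ^ 2 ≤ ∏ k ∈ {i, j}, P.prob k := by
    -- The two extreme points may coincide; `β ≤ 1` covers that case.
    calc β ^ 2 ≤ β ^ ({i, j} : Finset ι).card :=
          pow_le_pow_of_le_one hβ hβ1 Finset.card_le_two
      _ ≤ _ := by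
          rw [← Finset.prod_const]
          exact Finset.prod_le_prod (fun _ _ => hβ) fun k _ => hP k
  have h2 := P.sum_realizationProb_filter (A := {i, j}) (B := ∅) (Finset.disjoint_empty_right _)
  rw [Finset.prod_empty, mul_one] at h2
  rw [← h2] at h1
  calc β ^ 2 * dirWidth P.pt Finset.univ u
      ≤ (∑ R with {i, j} ⊆ R ∧ Disjoint ∅ R, P.realizationProb R) *
          dirWidth P.pt Finset.univ u := mul_le_mul_of_nonneg_right h1 (dirWidth_nonneg _ _)
    _ ≤ ∑ R with {i, j} ⊆ R ∧ Disjoint ∅ R, P.realizationProb R * dirWidth P.pt R u := by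
        rw [Finset.sum_mul]
        refine Finset.sum_le_sum fun R hR =>
          mul_le_mul_of_nonneg_left ?_ (P.realizationProb_nonneg R)
        have hs := (Finset.mem_filter.1 hR).2.1
        rw [hij]
        exact inner_sub_le_dirWidth _ _ (hs (by simp)) (hs (by simp))
    _ ≤ P.expWidth u := Finset.sum_le_sum_of_subset_of_nonneg (Finset.filter_subset _ _)
        fun R _ _ => mul_nonneg (P.realizationProb_nonneg R) (dirWidth_nonneg _ _)

/-- All points of `B` are absent with probability at most `(1 - β) ^ |B|`. -/
theorem sum_realizationProb_disjoint_le {β : ℝ} (hP : ∀ i, β ≤ P.prob i) (B : Finset ι) :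
    ∑ R with Disjoint B R, P.realizationProb R ≤ (1 - β) ^ B.card := by
  have h := P.sum_realizationProb_filter (A := ∅) (Finset.disjoint_empty_left B)
  simp only [Finset.empty_subset, true_and, Finset.prod_empty, one_mul] at h
  rw [h, ← Finset.prod_const]
  exact Finset.prod_le_prod (fun i _ => sub_nonneg.2 (P.prob_mem i).2) fun i _ =>
    sub_le_sub_left (hP i) 1

end Expectation

end StochasticPoints

/-! ### Loss of expected width under peeling. -/

section Peeling

variable {ι : Type*} [DecidableEq ι] {d : ℕ}

theorem mem_peeled_of_lt {Q : ℕ → Finset ι} {k m : ℕ} (h : k < m) {i : ι}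
    (hi : i ∈ Q k) : i ∈ peeled Q m :=
  Finset.mem_biUnion.2 ⟨k, Finset.mem_range.2 h, hi⟩

theorem peeled_mono {Q : ℕ → Finset ι} {k m : ℕ} (h : k ≤ m) : peeled Q k ⊆ peeled Q m :=
  Finset.biUnion_subset_biUnion_of_subset_left _ (Finset.range_subset_range.2 h)

variable [Fintype ι]

/-- Unless a peeling exhausts the points, it yields for every direction `u` one point in each round
such that, if one of these points is present, the support function in direction `u` suffers little
from the removal of the points that were not peeled off. -/
theorem IsPeeling.exists_witnesses {δ : ℝ} (hδ : 0 ≤ δ) {x : ι → EuclideanSpace ℝ (Fin d)} {L : ℕ}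
    {Q : ℕ → Finset ι} (h : IsPeeling δ x L Q) (hS : peeled Q L ≠ Finset.univ)
    (u : EuclideanSpace ℝ (Fin d)) :
    ∃ A : Finset ι, A.card = L ∧ ∀ R, ¬ Disjoint A R →
      (R ∩ peeled Q L).Nonempty ∧
      supportFn x R u ≤ supportFn x (R ∩ peeled Q L) u + δ * dirWidth x Finset.univ u := by
  obtain ⟨o, ho⟩ : ∃ o, o ∉ peeled Q L := by
    by_contra! hc
    exact hS (Finset.eq_univ_iff_forall.2 hc)
  have rest : ∀ k < L, ∀ i ∉ peeled Q L, i ∈ Finset.univ \ peeled Q k := fun k hk i hi =>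
    Finset.mem_sdiff.2 ⟨Finset.mem_univ _, fun hm => hi (peeled_mono hk.le hm)⟩
  have hne : ∀ k < L, (Finset.univ \ peeled Q k).Nonempty := fun k hk => ⟨o, rest k hk o ho⟩
  have ex : ∀ k, ∃ q, k < L → q ∈ Q k ∧ supportFn x (Q k) u = inner ℝ u (x q) := fun k => by
    by_cases hk : k < L
    · obtain ⟨q, hq⟩ := exists_supportFn_eq x u ((h k hk).2.1 (hne k hk))
      exact ⟨q, fun _ => hq⟩
    · exact ⟨o, fun hk' => absurd hk' hk⟩
  choose q hq using ex
  have hlt : ∀ k m, k < m → m < L → q k ≠ q m := fun k m hkm hm e => by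
    have h1 := (h m hm).1 (hq m hm).1
    rw [← e] at h1
    exact (Finset.mem_sdiff.1 h1).2 (mem_peeled_of_lt hkm (hq k (hkm.trans hm)).1)
  refine ⟨(Finset.range L).image q, ?_, fun R hR => ?_⟩
  · rw [Finset.card_image_of_injOn, Finset.card_range]
    intro k hk m hm e
    rw [Finset.mem_coe, Finset.mem_range] at hk hm
    rcases lt_trichotomy k m with hkm | hkm | hkm
    · exact absurd e (hlt k m hkm hm)
    · exact hkm
    · exact absurd e.symm (hlt m k hkm hk)
  · rw [Finset.not_disjoint_iff] at hR
    obtain ⟨j, hj, hjR⟩ := hR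
    obtain ⟨k, hk, rfl⟩ := Finset.mem_image.1 hj
    rw [Finset.mem_range] at hk
    have hmem : q k ∈ R ∩ peeled Q L :=
      Finset.mem_inter.2 ⟨hjR, mem_peeled_of_lt hk (hq k hk).1⟩
    refine ⟨⟨_, hmem⟩, ?_⟩
    have hw := mul_nonneg hδ (dirWidth_nonneg x (R := Finset.univ) u)
    obtain ⟨i, hi, e⟩ := exists_supportFn_eq x u ⟨_, hjR⟩
    rw [e]
    by_cases hiS : i ∈ peeled Q L
    · linarith [inner_le_supportFn x u (Finset.mem_inter.2 ⟨hi, hiS⟩)]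
    -- The maximizer `i` of `R` was never peeled, so it was available in round `k`, where the
    -- kernel's extreme point `q k` nearly dominates it.
    · have h1 := inner_le_supportFn x u (rest k hk i hiS)
      have h2 := (h k hk).supportFn_le u (hne k hk)
      have h3 := (hq k hk).2
      have h4 := inner_le_supportFn x u hmem
      have h5 : δ * dirWidth x (Finset.univ \ peeled Q k) u ≤ δ * dirWidth x Finset.univ u :=
        mul_le_mul_of_nonneg_left (dirWidth_mono x u (Finset.subset_univ _)) hδ
      linarith

theorem IsPeeling.expWidth_le {β δ : ℝ} (hδ : 0 ≤ δ) (P : StochasticPoints ι d)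
    (hP : ∀ i, β ≤ P.prob i) {L : ℕ} {Q : ℕ → Finset ι} (h : IsPeeling δ P.pt L Q)
    (hS : peeled Q L ≠ Finset.univ) (u : EuclideanSpace ℝ (Fin d)) :
    P.expWidth u ≤ (P.restrict (peeled Q L)).expWidth u +
      (2 * δ + 2 * (1 - β) ^ L) * dirWidth P.pt Finset.univ u := by
  obtain ⟨A, hA, hA'⟩ := h.exists_witnesses hδ hS u
  obtain ⟨B, hB, hB'⟩ := h.exists_witnesses hδ hS (-u)
  rw [dirWidth_neg] at hB'
  set w := dirWidth P.pt Finset.univ u with hw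
  have w0 : 0 ≤ w := dirWidth_nonneg _ _
  have hloss : ∀ R, dirWidth P.pt R u ≤ dirWidth P.pt (R ∩ peeled Q L) u + 2 * δ * w +
      (if Disjoint A R then w else 0) + (if Disjoint B R then w else 0) := fun R => by
    have h0 : 0 ≤ dirWidth P.pt (R ∩ peeled Q L) u := dirWidth_nonneg _ _
    have h1 : dirWidth P.pt R u ≤ w := dirWidth_mono _ _ (Finset.subset_univ _)
    have h2 := mul_nonneg hδ w0
    by_cases hAR : Disjoint A R
    · rw [if_pos hAR]
      split_ifs <;> linarith
    · by_cases hBR : Disjoint B R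
      · rw [if_pos hBR]
        split_ifs
        linarith
      · rw [if_neg hAR, if_neg hBR]
        have h3 := (hA' R hAR).2
        have h4 := (hB' R hBR).2
        rw [dirWidth, dirWidth]
        linarith
  have hsum : ∀ D : Finset ι, D.card = L →
      ∑ R, P.realizationProb R * (if Disjoint D R then w else 0) ≤ (1 - β) ^ L * w := fun D hD => by
    simp only [mul_ite, mul_zero]
    rw [← Finset.sum_filter, ← Finset.sum_mul, ← hD]
    exact mul_le_mul_of_nonneg_right (P.sum_realizationProb_disjoint_le hP D) w0
  have hA1 := hsum A hA
  have hB1 := hsum B hB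
  rw [P.expWidth_restrict]
  calc P.expWidth u ≤ ∑ R, P.realizationProb R * (dirWidth P.pt (R ∩ peeled Q L) u + 2 * δ * w +
      (if Disjoint A R then w else 0) + (if Disjoint B R then w else 0)) :=
        Finset.sum_le_sum fun R _ =>
          mul_le_mul_of_nonneg_left (hloss R) (P.realizationProb_nonneg R)
    _ = ∑ R, P.realizationProb R * dirWidth P.pt (R ∩ peeled Q L) u +
        (∑ R, P.realizationProb R) * (2 * δ * w) +
        ∑ R, P.realizationProb R * (if Disjoint A R then w else 0) +
        ∑ R, P.realizationProb R * (if Disjoint B R then w else 0) := by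
        simp only [mul_add, Finset.sum_add_distrib, Finset.sum_mul]
    _ ≤ _ := by
        rw [P.sum_realizationProb]
        linarith

theorem IsPeeling.isExpKernel {β δ ε : ℝ} (hβ : 0 < β) (hβ1 : β ≤ 1) (hδ : 0 ≤ δ)
    (P : StochasticPoints ι d) (hP : ∀ i, β ≤ P.prob i) {L : ℕ} {Q : ℕ → Finset ι}
    (h : IsPeeling δ P.pt L Q) (hε : 2 * δ + 2 * (1 - β) ^ L ≤ ε * β ^ 2) :
    StochasticPoints.IsExpKernel ε (P.restrict (peeled Q L)) P := by
  refine fun u => ⟨?_, P.expWidth_restrict_le _ u⟩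
  have h1 := P.sq_mul_dirWidth_univ_le_expWidth hβ.le hβ1 hP u
  have w0 : 0 ≤ dirWidth P.pt Finset.univ u := dirWidth_nonneg _ _
  have hε0 : 0 ≤ ε := by
    have : 0 ≤ ε * β ^ 2 := le_trans (by have := pow_nonneg (sub_nonneg.2 hβ1) L; positivity) hε
    exact nonneg_of_mul_nonneg_left this (by positivity)
  -- An exhausted set loses nothing; witnesses for every round exist only otherwise.
  by_cases hS : peeled Q L = Finset.univ
  · have h2 : (P.restrict (peeled Q L)).expWidth u = P.expWidth u := by
      rw [P.expWidth_restrict, hS]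
      simp [StochasticPoints.expWidth]
    rw [h2]
    nlinarith [mul_nonneg (sq_nonneg β) w0]
  · have h2 := h.expWidth_le hδ P hP hS u
    have h3 := mul_le_mul_of_nonneg_right hε w0
    have h4 := mul_le_mul_of_nonneg_left h1 hε0
    linarith

/-- Peeling succeeds for any number of rounds if kernels exist. -/
theorem exists_isPeeling {δ b : ℝ} (x : ι → EuclideanSpace ℝ (Fin d))
    (h : ∀ R : Finset ι, ∃ Q : Finset ι, IsKernel δ x Q R ∧ (Q.card : ℝ) ≤ b) :
    ∃ Q : ℕ → Finset ι, ∀ k, IsKernel δ x (Q k) (Finset.univ \ peeled Q k) ∧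
      ((Q k).card : ℝ) ≤ b := by
  choose K hK using h
  -- Each choice depends on all earlier ones only through their union, so the recursion runs on that
  -- union.
  let T : ℕ → Finset ι := fun k => Nat.rec ∅ (fun _ t => t ∪ K (Finset.univ \ t)) k
  have hT : ∀ k, peeled (fun k => K (Finset.univ \ T k)) k = T k := fun k => by
    induction k with
    | zero => rfl
    | succ k ih =>
      rw [peeled, Finset.range_add_one, Finset.biUnion_insert, ← peeled, ih, Finset.union_comm]
  exact ⟨fun k => K (Finset.univ \ T k), fun k => by rw [hT]; exact hK _⟩

end Peeling

/-! ### Existence of small deterministic kernels. -/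

section Kernels

/-- Some subfamily of a finite family of vectors expresses all of them with coefficients in
`[-1, 1]`: choose it to maximise the absolute value of the determinant. -/
theorem exists_bounded_coords {κ E : Type*} [Finite κ] [Nonempty κ] [AddCommGroup E] [Module ℝ E]
    [FiniteDimensional ℝ E] (g : κ → E) :
    ∃ k ≤ Module.finrank ℝ E, ∃ (f : Fin k → κ) (c : κ → Fin k → ℝ),
      (∀ i j, |c i j| ≤ 1) ∧ ∀ i, g i = ∑ j, c i j • g (f j) := by
  obtain ⟨v, hv, -, hli⟩ := Submodule.exists_fun_fin_finrank_span_eq ℝ (Set.range g)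
  let W := Submodule.span ℝ (Set.range g)
  choose f₀ hf₀ using hv
  let gW : κ → W := fun i => ⟨g i, Submodule.subset_span ⟨i, rfl⟩⟩
  have hli' : LinearIndependent ℝ (gW ∘ f₀) := by
    have e : v = W.subtype ∘ gW ∘ f₀ := funext fun i => (hf₀ i).symm
    rw [e] at hli
    exact LinearIndependent.of_comp W.subtype hli
  let b := Module.finBasis ℝ W
  obtain ⟨f, hf⟩ := Finite.exists_max fun f : Fin (Module.finrank ℝ W) → κ => |b.det (gW ∘ f)|
  have h0 : b.det (gW ∘ f₀) ≠ 0 := by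
    refine isUnit_iff_ne_zero.1 ((Module.Basis.is_basis_iff_det b).1 ⟨hli', ?_⟩)
    exact hli'.span_eq_top_of_card_eq_finrank' (Fintype.card_fin _)
  have hdet : b.det (gW ∘ f) ≠ 0 := abs_pos.1 ((abs_pos.2 h0).trans_le (hf f₀))
  obtain ⟨h1, h2⟩ := (Module.Basis.is_basis_iff_det b).2 (isUnit_iff_ne_zero.2 hdet)
  let b' := Module.Basis.mk h1 h2.ge
  refine ⟨_, Submodule.finrank_le W, f, fun i j => b'.coord j (gW i), fun i j => ?_, fun i => ?_⟩
  -- Cramer's rule: a coordinate times the determinant is the determinant with one vector replaced,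
  -- and the latter is no larger by maximality.
  · have h3 := congrArg (fun l => |l (gW i)|) (b.det_smul_mk_coord_eq_det_update h1 h2.ge j)
    simp only [LinearMap.smul_apply, smul_eq_mul, abs_mul] at h3
    have h4 := hf (Function.update f j i)
    rw [Function.comp_update] at h4
    exact le_of_mul_le_mul_left ((h3.trans_le h4).trans_eq (mul_one _).symm) (abs_pos.2 hdet)
  · have h3 := congrArg W.subtype (b'.sum_repr (gW i))
    rw [map_sum] at h3
    simpa [b', gW] using h3.symm

theorem exists_abs_sub_fin_le_one {m : ℕ} (hm : 0 < m) {t : ℝ} (h0 : 0 ≤ t) (h1 : t ≤ m) :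
    ∃ g : Fin m, |t - (g : ℕ)| ≤ 1 := by
  rcases h1.lt_or_eq with h | rfl
  · refine ⟨⟨⌊t⌋₊, (Nat.floor_lt h0).2 h⟩, ?_⟩
    rw [abs_le]
    constructor <;> linarith [Nat.floor_le h0, Nat.lt_floor_add_one t]
  -- At `t = m` the floor falls outside `Fin m`.
  · refine ⟨⟨m - 1, by omega⟩, ?_⟩
    simp [Nat.cast_sub (Nat.one_le_of_lt hm)]

/-- The ray from `p` along `a` must cross the sphere of radius 2. The bound `1 ≤ t * ‖a‖` later
turns an error divided by `t` into a multiple of `‖a‖`. -/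
theorem exists_norm_add_smul_eq_two {E : Type*} [NormedAddCommGroup E] [NormedSpace ℝ E]
    {p a : E} (hp : ‖p‖ ≤ 1) (ha : a ≠ 0) :
    ∃ t : ℝ, 0 ≤ t ∧ 1 ≤ t * ‖a‖ ∧ ‖p + t • a‖ = 2 := by
  have ha' : 0 < ‖a‖ := norm_pos_iff.2 ha
  have hs : 0 ≤ 3 / ‖a‖ := by positivity
  have hcont : ContinuousOn (fun t : ℝ => ‖p + t • a‖) (Set.Icc 0 (3 / ‖a‖)) := by fun_prop
  have h2 : (2 : ℝ) ∈ Set.Icc ‖p + (0 : ℝ) • a‖ ‖p + (3 / ‖a‖) • a‖ := by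
    constructor
    · rw [zero_smul, add_zero]
      linarith
    · have h3 : ‖(3 / ‖a‖) • a‖ = 3 := by
        rw [norm_smul, Real.norm_of_nonneg hs, div_mul_cancel₀ _ ha'.ne']
      have h4 := norm_sub_le (p + (3 / ‖a‖) • a) p
      rw [add_sub_cancel_left, h3] at h4
      linarith
  obtain ⟨t, ht, e⟩ := intermediate_value_Icc hs hcont h2
  refine ⟨t, ht.1, ?_, e⟩
  have h5 := norm_add_le p (t • a)
  rw [norm_smul, Real.norm_of_nonneg ht.1] at h5
  simp only at e
  linarith

/-- The boundary of the cube `[-2, 2] ^ (k + 1)` has a `4 / m`-net of `2 (k + 1) m ^ k` points. -/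
theorem exists_net_sphere_two (k : ℕ) {m : ℕ} (hm : 0 < m) :
    ∃ Z : Finset (Fin (k + 1) → ℝ), Z.card ≤ 2 * (k + 1) * m ^ k ∧
      ∀ w : Fin (k + 1) → ℝ, ‖w‖ = 2 → ∃ z ∈ Z, ∀ l, |z l - w l| ≤ 4 / m := by
  classical
  -- A face (coordinate and sign) together with a grid point of that face.
  let net : Fin (k + 1) × Bool × (Fin k → Fin m) → Fin (k + 1) → ℝ := fun s =>
    Fin.insertNth (α := fun _ => ℝ) s.1 (if s.2.1 then 2 else -2)
      fun l => -2 + 4 / m * ((s.2.2 l : ℕ) : ℝ)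
  have hm' : (0 : ℝ) < m := Nat.cast_pos.2 hm
  refine ⟨Finset.univ.image net, Finset.card_image_le.trans (le_of_eq ?_), fun w hw => ?_⟩
  · simp
    ring
  obtain ⟨j, hj⟩ : ∃ j, 2 ≤ |w j| := by
    by_contra! h
    exact hw.not_lt ((pi_norm_lt_iff two_pos).2 h)
  have hle : ∀ l, |w l| ≤ 2 := fun l => (norm_le_pi_norm w l).trans_eq hw
  have hgrid : ∀ l, ∃ g : Fin m, |-2 + 4 / m * ((g : ℕ) : ℝ) - w (j.succAbove l)| ≤ 4 / m := by
    intro l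
    obtain ⟨h1, h2⟩ := abs_le.1 (hle (j.succAbove l))
    obtain ⟨g, hg⟩ := exists_abs_sub_fin_le_one hm (t := (w (j.succAbove l) + 2) * (m / 4))
      (mul_nonneg (by linarith) (by positivity)) (by nlinarith)
    refine ⟨g, ?_⟩
    have e : -2 + 4 / m * ((g : ℕ) : ℝ) - w (j.succAbove l) =
        -(4 / m * ((w (j.succAbove l) + 2) * (m / 4) - (g : ℕ))) := by
      field_simp
      ring
    rw [e, abs_neg, abs_mul, abs_of_pos (by positivity : (0 : ℝ) < 4 / m)]
    exact mul_le_of_le_one_right (by positivity) hg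
  choose g hg using hgrid
  refine ⟨net (j, decide (0 ≤ w j), g), Finset.mem_image_of_mem _ (Finset.mem_univ _), fun l => ?_⟩
  induction l using Fin.succAboveCases j with
  | x =>
    have h4 : (0 : ℝ) ≤ 4 / m := by positivity
    have h3 := hle j
    by_cases h : 0 ≤ w j
    · rw [abs_of_nonneg h] at hj h3
      simpa [net, h, le_antisymm h3 hj] using h4
    · rw [abs_of_neg (not_le.1 h)] at hj h3
      have h5 : w j = -2 := by linarith
      have h6 : ¬ (2 : ℝ) ≤ 0 := by norm_num
      simpa [net, h5, h6] using h4
  | p l => simpa [net] using hg l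

/-- For points in the cube `[-1, 1] ^ (k + 1)`, the nearest neighbours of the points of a net of the
boundary of a larger cube are nearly extremal in all directions. -/
theorem exists_nearly_extremal {κ : Type*} [Finite κ] [Nonempty κ] (k : ℕ) {m : ℕ} (hm : 0 < m)
    (y : κ → Fin (k + 1) → ℝ) (hy : ∀ i j, |y i j| ≤ 1) :
    ∃ Q : Finset κ, Q.card ≤ 2 * (k + 1) * m ^ k ∧ ∀ (a : Fin (k + 1) → ℝ) (p : κ), ∃ q ∈ Q,
      ∑ j, a j * y p j ≤ ∑ j, a j * y q j + (k + 1) * (4 / m) ^ 2 / 2 * ‖a‖ := by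
  classical
  obtain ⟨Z, hZ, hnet⟩ := exists_net_sphere_two k hm
  choose q hq using fun z : Fin (k + 1) → ℝ => Finite.exists_min fun i => ∑ l, (z l - y i l) ^ 2
  refine ⟨Z.image q, Finset.card_image_le.trans hZ, fun a p => ?_⟩
  by_cases ha : a = 0
  · obtain ⟨z, hz, -⟩ := hnet (fun _ => 2) (by rw [pi_norm_const]; norm_num)
    exact ⟨q z, Finset.mem_image_of_mem _ hz, by simp [ha]⟩
  have hp : ‖y p‖ ≤ 1 := (pi_norm_le_iff_of_nonneg zero_le_one).2 (hy p)
  obtain ⟨t, ht, hta, htw⟩ := exists_norm_add_smul_eq_two hp ha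
  obtain ⟨z, hz, hzw⟩ := hnet _ htw
  refine ⟨q z, Finset.mem_image_of_mem _ hz, ?_⟩
  have h1 : ∑ l, ((z l - y p l) ^ 2 - (z l - y (q z) l) ^ 2) ≥ 0 := by
    rw [Finset.sum_sub_distrib]
    exact sub_nonneg.2 (hq z p)
  -- Per coordinate, let `e` be the offset of `z` from `y p + t • a` and `s` that of `y (q z)` from
  -- `y p`. The difference of squares is `2 * t * a * s + 2 * e * s - s ^ 2`, and `2 * e * s - s ^ 2
  -- ≤ e ^ 2`: the error is quadratic in the mesh.
  have h2 : ∑ l, ((z l - y p l) ^ 2 - (z l - y (q z) l) ^ 2) ≤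
      ∑ l, (2 * t * (a l * y (q z) l - a l * y p l) + (4 / m) ^ 2) := by
    refine Finset.sum_le_sum fun l _ => ?_
    have h3 := sq_le_sq' (abs_le.1 (hzw l)).1 (abs_le.1 (hzw l)).2
    simp only [Pi.add_apply, Pi.smul_apply, smul_eq_mul] at h3
    nlinarith [sq_nonneg (z l - (y p l + t * a l) - (y (q z) l - y p l))]
  rw [Finset.sum_add_distrib, ← Finset.mul_sum,
    Finset.sum_sub_distrib (fun l => a l * y (q z) l) (fun l => a l * y p l), Finset.sum_const,
    Finset.card_univ, Fintype.card_fin, nsmul_eq_mul] at h2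
  push_cast at h2
  have ht0 : 0 < t := ht.lt_of_ne fun h => by
    rw [← h, zero_mul] at hta
    linarith
  have h4 : 0 ≤ ((k : ℝ) + 1) * (4 / m) ^ 2 := by positivity
  refine le_of_mul_le_mul_left ?_ ht0
  nlinarith

theorem exists_isKernel {d : ℕ} (hd : 1 ≤ d) {ι : Type*} (x : ι → EuclideanSpace ℝ (Fin d))
    (R : Finset ι) {δ : ℝ} (hδ : 0 < δ) (hδ1 : δ ≤ 1) :
    ∃ Q : Finset ι, IsKernel δ x Q R ∧
      (Q.card : ℝ) ≤ 2 * d * (5 * √d) ^ (d - 1) * δ ^ (-((d : ℝ) - 1) / 2) := by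
  have hd' : (1 : ℝ) ≤ d := Nat.one_le_cast.2 hd
  have hs1 : 1 ≤ √(d / δ) := by
    rw [Real.one_le_sqrt, one_le_div hδ]
    linarith
  have hpow : 2 * d * (5 * √d) ^ (d - 1) * δ ^ (-((d : ℝ) - 1) / 2) =
      2 * d * (5 * √(d / δ)) ^ (d - 1) := by
    have h : δ ^ (-((d : ℝ) - 1) / 2) = ((√δ)⁻¹) ^ (d - 1) := by
      rw [Real.sqrt_eq_rpow, ← Real.rpow_neg hδ.le, ← Real.rpow_natCast, ← Real.rpow_mul hδ.le,
        Nat.cast_sub hd]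
      congr 1
      push_cast
      ring
    rw [h, mul_assoc, ← mul_pow, Real.sqrt_div (by positivity), div_eq_mul_inv, mul_assoc 5]
  rw [hpow]
  rcases R.eq_empty_or_nonempty with rfl | ⟨o, ho⟩
  · refine ⟨∅, isKernel_of_forall_exists (Finset.Subset.refl _) (by simp), ?_⟩
    rw [Finset.card_empty, Nat.cast_zero]
    positivity
  have : Nonempty {i // i ∈ R} := ⟨⟨o, ho⟩⟩
  obtain ⟨k, hk, f, c, hc, hx⟩ := exists_bounded_coords fun i : {i // i ∈ R} => x i - x o
  rw [finrank_euclideanSpace_fin] at hk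
  have hin : ∀ (u : EuclideanSpace ℝ (Fin d)) (i : {i // i ∈ R}), inner ℝ u (x i) =
      inner ℝ u (x o) + ∑ j, inner ℝ u (x (f j) - x o) * c i j := fun u i => by
    rw [← sub_eq_iff_eq_add', ← inner_sub_right, hx i, inner_sum]
    simp_rw [real_inner_smul_right, mul_comm]
  rcases k with _ | k
  -- The differences `x i - x o` span a zero space: all points coincide.
  · refine ⟨{o}, isKernel_of_forall_exists (by simpa using ho) fun u p hp =>
      ⟨o, Finset.mem_singleton_self o, ?_⟩, ?_⟩
    · have h1 := hin u ⟨p, hp⟩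
      have h2 := dirWidth_nonneg x (R := R) u
      simp only [Finset.univ_eq_empty, Finset.sum_empty] at h1
      rw [h1]
      nlinarith
    · rw [Finset.card_singleton, Nat.cast_one]
      have := one_le_pow₀ (n := d - 1) (show 1 ≤ 5 * √(d / δ) by linarith)
      nlinarith
  -- This mesh makes `(k + 1) * (4 / m) ^ 2 ≤ δ`, since `k + 1 ≤ d`.
  · set m := ⌈4 * √(d / δ)⌉₊ with hm
    have hm1 : 4 * √(d / δ) ≤ m := Nat.le_ceil _
    have hm2 : (m : ℝ) ≤ 5 * √(d / δ) := by
      linarith [Nat.ceil_lt_add_one (show 0 ≤ 4 * √(d / δ) by positivity)]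
    have hm0 : (0 : ℝ) < m := by linarith
    obtain ⟨Q, hQ, hext⟩ := exists_nearly_extremal k (Nat.cast_pos.1 hm0) c hc
    have hkd : (k : ℝ) + 1 ≤ d := by exact_mod_cast hk
    have hloss : (k + 1) * (4 / m) ^ 2 ≤ δ := by
      have h1 : 16 * (d / δ) ≤ (m : ℝ) ^ 2 := by
        calc 16 * (d / δ) = (4 * √(d / δ)) ^ 2 := by
              rw [mul_pow, Real.sq_sqrt (by positivity)]
              norm_num
          _ ≤ _ := by gcongr
      rw [mul_div_assoc', div_le_iff₀ hδ] at h1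
      rw [div_pow, mul_div_assoc', div_le_iff₀ (by positivity)]
      nlinarith
    refine ⟨Q.map (Function.Embedding.subtype (· ∈ R)),
      isKernel_of_forall_exists (Finset.map_subtype_subset Q) fun u p hp => ?_, ?_⟩
    · obtain ⟨q, hq, h⟩ := hext (fun j => inner ℝ u (x (f j) - x o)) ⟨p, hp⟩
      refine ⟨q, Finset.mem_map_of_mem _ hq, ?_⟩
      have h1 := hin u ⟨p, hp⟩
      have h2 := hin u q
      simp only at h1
      rw [h1, h2]
      have hw := dirWidth_nonneg x (R := R) u
      -- The linear functional has coefficients that are themselves differences of values in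
      -- direction `u`, so the width bounds its norm.
      have h3 : ‖fun j => inner ℝ u (x (f j) - x o)‖ ≤ dirWidth x R u := by
        refine (pi_norm_le_iff_of_nonneg hw).2 fun j => abs_le.2 ⟨?_, ?_⟩
        · have := inner_sub_le_dirWidth x u ho (f j).2
          rw [← neg_sub, inner_neg_right] at this
          linarith
        · exact inner_sub_le_dirWidth x u (f j).2 ho
      have h4 := mul_le_mul (div_le_div_of_nonneg_right hloss zero_le_two) h3 (norm_nonneg _)
        (by positivity)
      linarith
    · rw [Finset.card_map]
      have h1 : (m : ℝ) ^ k ≤ (5 * √(d / δ)) ^ (d - 1) :=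
        (pow_le_pow_left₀ hm0.le hm2 k).trans (pow_le_pow_right₀ (by linarith) (by omega))
      calc (Q.card : ℝ) ≤ 2 * (k + 1) * (m : ℝ) ^ k := by exact_mod_cast hQ
        _ ≤ _ := by gcongr

end Kernels

/-! ### Number of rounds and choice of constants. -/

/-- The number of rounds after which the chance of missing an extreme point is at most `κ ε`. -/
theorem exists_rounds {b κ : ℝ} (hb : 0 < b) (hb1 : b ≤ 1) (hκ : 0 < κ) (hκ1 : κ ≤ 1) {ε : ℝ}
    (hε : 0 < ε) (hε1 : ε < 1) :
    ∃ L : ℕ, (1 - b) ^ L ≤ κ * ε ∧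
      (L : ℝ) ≤ ((1 + Real.log (1 / κ) / Real.log 2) / b + 1 / Real.log 2) * Real.log (2 / ε) := by
  have hl2 : 0 < Real.log 2 := Real.log_pos one_lt_two
  have hl : Real.log 2 ≤ Real.log (2 / ε) :=
    Real.log_le_log two_pos (by rw [le_div_iff₀ hε]; linarith)
  have hlκ : 0 ≤ Real.log (1 / κ) := Real.log_nonneg (by rwa [one_le_div hκ])
  have hsplit : Real.log (1 / (κ * ε)) ≤ Real.log (1 / κ) + Real.log (2 / ε) := by
    rw [← Real.log_mul (by positivity) (by positivity)]
    refine Real.log_le_log (by positivity) ?_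
    rw [div_mul_div_comm]
    gcongr
    norm_num
  have h0 : 0 ≤ Real.log (1 / (κ * ε)) :=
    Real.log_nonneg (by rw [one_le_div (by positivity)]; nlinarith)
  refine ⟨⌈Real.log (1 / (κ * ε)) / b⌉₊, ?_, ?_⟩
  · have h1 := Nat.le_ceil (Real.log (1 / (κ * ε)) / b)
    rw [div_le_iff₀ hb] at h1
    calc (1 - b) ^ ⌈Real.log (1 / (κ * ε)) / b⌉₊
        ≤ Real.exp (-b) ^ ⌈Real.log (1 / (κ * ε)) / b⌉₊ :=
          pow_le_pow_left₀ (by linarith) (Real.one_sub_le_exp_neg b) _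
      _ = Real.exp (-(⌈Real.log (1 / (κ * ε)) / b⌉₊ * b)) := by
          rw [← Real.exp_nat_mul]
          ring_nf
      _ ≤ Real.exp (-Real.log (1 / (κ * ε))) := by gcongr
      _ = κ * ε := by
          rw [one_div, Real.log_inv, neg_neg, Real.exp_log (by positivity)]
  · have h1 := (Nat.ceil_lt_add_one (div_nonneg h0 hb.le)).le
    -- As `log (2 / ε) ≥ log 2`, additive constants are absorbed into multiples of `log (2 / ε)`.
    have h2 : 1 ≤ 1 / Real.log 2 * Real.log (2 / ε) := by
      rwa [one_div_mul_eq_div, one_le_div hl2]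
    have h3 : Real.log (1 / κ) ≤ Real.log (1 / κ) / Real.log 2 * Real.log (2 / ε) := by
      rw [div_mul_eq_mul_div, le_div_iff₀ hl2]
      gcongr
    calc _ ≤ Real.log (1 / (κ * ε)) / b + 1 := h1
      _ ≤ ((1 + Real.log (1 / κ) / Real.log 2) * Real.log (2 / ε)) / b +
          1 / Real.log 2 * Real.log (2 / ε) := by
          gcongr
          linarith
      _ = _ := by ring

theorem mainTheorem5 (d : ℕ) (hd : 1 ≤ d) (β : ℝ) (hβ : 0 < β) :
    ∃ c C : ℝ, 0 < c ∧ c ≤ 1 ∧ 0 < C ∧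
      ∀ ε : ℝ, 0 < ε → ε < 1 →
        ∃ L : ℕ, (L : ℝ) ≤ C * Real.log (2 / ε) ∧
          ∀ (n : ℕ) (P : StochasticPoints (Fin n) d), (∀ i, β ≤ P.prob i) →
            (∃ S : Finset (Fin n),
              (S.card : ℝ) ≤ C * ε ^ (-((d : ℝ) - 1) / 2) * Real.log (2 / ε) ∧
              StochasticPoints.IsExpKernel ε (P.restrict S) P ∧
              ∃ Q : ℕ → Finset (Fin n), IsPeeling (c * ε) P.pt L Q ∧ S = peeled Q L ∧
                ∀ k < L, ((Q k).card : ℝ) ≤ C * ε ^ (-((d : ℝ) - 1) / 2)) ∧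
            (∀ Q : ℕ → Finset (Fin n), IsPeeling (c * ε) P.pt L Q →
              StochasticPoints.IsExpKernel ε (P.restrict (peeled Q L)) P) := by
  -- `β > 1` is possible only when there are no points.
  set b := min β 1 with hb_def
  have hb : 0 < b := lt_min hβ one_pos
  have hb1 : b ≤ 1 := min_le_right _ _
  have hd0 : (0 : ℝ) < d := Nat.cast_pos.2 hd
  -- Kernel error and missed witnesses each cost at most `2 * c * ε`, which exactly exhausts the
  -- allowance `ε * b ^ 2`.
  set c := b ^ 2 / 4 with hc_def
  have hc : 0 < c := by positivity
  have hc1 : c ≤ 1 := by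
    rw [hc_def]
    nlinarith
  set C₁ := (1 + Real.log (1 / c) / Real.log 2) / b + 1 / Real.log 2 with hC₁
  have hC₁0 : 0 < C₁ := by
    have : 0 ≤ Real.log (1 / c) := Real.log_nonneg (by rwa [one_le_div hc])
    have : 0 < Real.log 2 := Real.log_pos one_lt_two
    positivity
  set C₂ := 2 * d * (5 * √d) ^ (d - 1) * c ^ (-((d : ℝ) - 1) / 2) with hC₂
  have hC₂0 : 0 < C₂ := by positivity
  -- One constant serves the number of rounds, the size of each kernel and the size of their union.
  have hC : C₁ ≤ C₁ + C₂ + C₁ * C₂ ∧ C₂ ≤ C₁ + C₂ + C₁ * C₂ ∧ C₁ * C₂ ≤ C₁ + C₂ + C₁ * C₂ := by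
    have := mul_pos hC₁0 hC₂0
    refine ⟨?_, ?_, ?_⟩ <;> linarith
  refine ⟨c, C₁ + C₂ + C₁ * C₂, hc, hc1, by positivity, fun ε hε hε1 => ?_⟩
  obtain ⟨L, hL, hLC⟩ := exists_rounds hb hb1 hc hc1 hε hε1
  have hlog : 0 < Real.log (2 / ε) := Real.log_pos (by rw [lt_div_iff₀ hε]; linarith)
  refine ⟨L, hLC.trans (mul_le_mul_of_nonneg_right hC.1 hlog.le), fun n P hP => ?_⟩
  have hexp : ∀ Q : ℕ → Finset (Fin n), IsPeeling (c * ε) P.pt L Q →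
      StochasticPoints.IsExpKernel ε (P.restrict (peeled Q L)) P := fun Q hQ =>
    hQ.isExpKernel hb hb1 (by positivity) P (fun i => (min_le_left _ _).trans (hP i)) (by
      have : ε * b ^ 2 = 2 * (c * ε) + 2 * (c * ε) := by rw [hc_def]; ring
      linarith)
  refine ⟨?_, hexp⟩
  obtain ⟨Q, hQ⟩ := exists_isPeeling (b := C₂ * ε ^ (-((d : ℝ) - 1) / 2)) P.pt fun R => by
    obtain ⟨Q, hQ, hcard⟩ := exists_isKernel hd P.pt R (mul_pos hc hε) (by nlinarith)
    rw [Real.mul_rpow hc.le hε.le, ← mul_assoc] at hcard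
    exact ⟨Q, hQ, hcard⟩
  have hpeel : IsPeeling (c * ε) P.pt L Q := fun k _ => (hQ k).1
  refine ⟨peeled Q L, ?_, hexp Q hpeel, Q, hpeel, rfl, fun k _ => (hQ k).2.trans ?_⟩
  · calc ((peeled Q L).card : ℝ) ≤ ∑ k ∈ Finset.range L, ((Q k).card : ℝ) := by
          exact_mod_cast Finset.card_biUnion_le
      _ ≤ L * (C₂ * ε ^ (-((d : ℝ) - 1) / 2)) := by
          refine (Finset.sum_le_card_nsmul _ _ _ fun k _ => (hQ k).2).trans_eq ?_
          rw [Finset.card_range, nsmul_eq_mul]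
      _ ≤ C₁ * Real.log (2 / ε) * (C₂ * ε ^ (-((d : ℝ) - 1) / 2)) := by gcongr
      _ = C₁ * C₂ * ε ^ (-((d : ℝ) - 1) / 2) * Real.log (2 / ε) := by ring
      _ ≤ _ := by
          gcongr
          exact hC.2.2
  · gcongr
    exact hC.2.1
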